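/- Let $B>2$ be an integer. There is a constant $c>0$, depending only on $B$, such that the following holds for every bipartite graph $H$ with $B$ vertices. Let $d\ge 1$, and let $G$ be a finite simple $d$-regular graph on $n$ vertices that contains no copy of $H$ as a (not necessarily induced) subgraph. Then $G$ has an induced matching with at least $c\,\frac{n}{d}\log d$ edges. Here $\log$ is the natural logarithm, and an induced matching of $G$ is a matching $M$ in $G$ such that no two distinct edges of $M$ are joined by an edge of $G$. -/

import Mathlib

/-- A subgraph `M` of `G` is an *induced matching* of `G` if it is a matching and no two distinct
edges of `M` are joined by an edge of `G`. (In a matching distinct edges share no vertex, so such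
a joining edge is automatically a third edge.) -/
def SimpleGraph.Subgraph.IsInducedMatching {V : Type*} {G : SimpleGraph V}
    (M : G.Subgraph) : Prop :=
  M.IsMatching ∧
    ∀ e ∈ M.edgeSet, ∀ f ∈ M.edgeSet, e ≠ f → ∀ u ∈ e, ∀ v ∈ f, ¬ G.Adj u v

/-- Equivalently, `M` is a matching that is an induced subgraph of `G`. -/
theorem SimpleGraph.Subgraph.isInducedMatching_iff {V : Type*} {G : SimpleGraph V}
    (M : G.Subgraph) : M.IsInducedMatching ↔ M.IsMatching ∧ M.IsInduced := by
  constructor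
  · rintro ⟨hM, h⟩
    refine ⟨hM, fun u hu v hv huv => ?_⟩
    obtain ⟨a, ha, -⟩ := hM hu
    obtain ⟨b, hb, -⟩ := hM hv
    by_cases he : s(u, a) = s(v, b)
    · rcases Sym2.eq_iff.1 he with ⟨h1, -⟩ | ⟨-, h2⟩
      · exact absurd h1 huv.ne
      · exact h2 ▸ ha
    · exact absurd huv (h s(u, a) ha s(v, b) hb he u (Sym2.mem_mk_left _ _) v
        (Sym2.mem_mk_left _ _))
  · rintro ⟨hM, h⟩
    refine ⟨hM, fun e he f hf hef u hu v hv huv => hef ?_⟩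
    obtain ⟨a, rfl⟩ := Sym2.mem_iff_exists.1 hu
    obtain ⟨b, rfl⟩ := Sym2.mem_iff_exists.1 hv
    have he' : M.Adj u a := he
    have hf' : M.Adj v b := hf
    have huv' := h he'.fst_mem hf'.fst_mem huv
    have h1 : a = v := (hM he'.fst_mem).unique he' huv'
    have h2 : b = u := (hM hf'.fst_mem).unique hf' huv'.symm
    rw [h1, h2, Sym2.eq_swap]

/-!
An induced matching of `G` is an independent set in the square of the line graph of `G`. For a
`d`-regular `G` that square has about `n * d / 2` vertices and maximum degree of order `d ^ 2`, so a
greedy choice gives `n / d` edges up to a constant. The extra `log d` comes from sparsity.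

A bipartite graph on `B` vertices is contained in `K_{B,B}`, so `G` has no `K_{t,t}` with `t = B`
(`exists_not_adj_of_free`). By the Kővári–Sós–Turán bound (`sum_adj_le`) the neighbourhoods of any
two vertices span only `O(d ^ (2 - 1 / t))` edges between them. Hence among the `O(d ^ 4)` pairs of
edges near a given edge, only `O(d ^ (4 - 1 / t))` are in conflict with each other
(`card_conflict_pairs_le`): the square of the line graph is locally sparse by a power of its degree.
Edges are represented by darts, that is ordered pairs of adjacent vertices; the two orientations of
an edge are in conflict, so an independent set of darts uses each edge at most once.

Locally sparse graphs have independent sets larger than the greedy bound by a logarithmic factor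
(`exists_independent_of_sparse`). To see this, take a random independent set `I` with probability
proportional to `lam ^ #I`, with `lam` equal to `d ^ (1 / (2 * t) - 2)`, and fix a vertex `v` and the
part of `I` outside the closed neighbourhood of `v`. Let `A` be the set of vertices of that closed
neighbourhood which are still available. If `lam * #A` is small compared to `log d`, then the
partition function of `A` is at most a small power of `d`, and `v` itself is chosen with probability
of order at least `d ^ (-2) * log d`. Otherwise, by sparsity, the expected size of `I` within `A` is
at least about `lam * #A`, which is of order at least `log d`. So the weighted count
`K * [v ∈ I] + #(I ∩ N[v])`, with `K` of order `d ^ 2`, has expectation of order at least `log d` for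
every `v`. The sum of these counts over `v` is at most of order `d ^ 2 * #I`, so some `I` is as large
as claimed.
-/

namespace InducedMatching

open Finset

/-! ### The hard-core model on a sparse conflict relation -/

open scoped Classical in
/-- The weight of a finite set `S` in the hard-core model at fugacity `lam` on the conflict relation
`R`: it is `lam ^ #S` if no two distinct elements of `S` are in conflict, and `0` otherwise. -/
noncomputable def weight {α : Type*} (R : α → α → Prop) (lam : ℝ) (S : Finset α) : ℝ :=
  if (S : Set α).Pairwise (fun a b => ¬ R a b) then lam ^ #S else 0

/-- The partition function of the hard-core model restricted to subsets of `A`. -/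
noncomputable def partitionFn {α : Type*} (R : α → α → Prop) (lam : ℝ) (A : Finset α) : ℝ :=
  ∑ S ∈ A.powerset, weight R lam S

section HardCore

variable {α : Type*} {R : α → α → Prop} {lam : ℝ}

lemma weight_nonneg (hl : 0 ≤ lam) (S : Finset α) : 0 ≤ weight R lam S := by
  unfold weight; split_ifs <;> positivity

lemma weight_empty : weight R lam ∅ = 1 := by
  simp [weight]

lemma partitionFn_nonneg (hl : 0 ≤ lam) (A : Finset α) : 0 ≤ partitionFn R lam A :=
  sum_nonneg fun S _ => weight_nonneg hl S

variable [DecidableEq α]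

lemma weight_insert_le (hl : 0 ≤ lam) {a : α} {S : Finset α} (ha : a ∉ S) :
    weight R lam (insert a S) ≤ lam * weight R lam S := by
  unfold weight
  by_cases h : ((insert a S : Finset α) : Set α).Pairwise (fun a b => ¬ R a b)
  · have h' : (S : Set α).Pairwise (fun a b => ¬ R a b) :=
      h.mono (by simp)
    rw [if_pos h, if_pos h', card_insert_of_notMem ha, pow_succ']
  · rw [if_neg h]
    split_ifs <;> positivity

lemma weight_union (hs : ∀ a b, R a b → R b a) {S T : Finset α} (hd : Disjoint S T)
    (h : ∀ a ∈ S, ∀ b ∈ T, ¬ R a b) :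
    weight R lam (S ∪ T) = weight R lam S * weight R lam T := by
  unfold weight
  have key : ((S ∪ T : Finset α) : Set α).Pairwise (fun a b => ¬ R a b) ↔
      (S : Set α).Pairwise (fun a b => ¬ R a b) ∧ (T : Set α).Pairwise (fun a b => ¬ R a b) := by
    rw [coe_union, Set.pairwise_union]
    exact ⟨fun H => ⟨H.1, H.2.1⟩, fun H => ⟨H.1, H.2, fun a ha b hb _ =>
      ⟨h a ha b hb, fun hba => h a ha b hb (hs _ _ hba)⟩⟩⟩
  by_cases h1 : (S : Set α).Pairwise (fun a b => ¬ R a b) <;>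
    by_cases h2 : (T : Set α).Pairwise (fun a b => ¬ R a b) <;>
    simp only [key, h1, h2, card_union_of_disjoint hd, pow_add, and_true, and_false, and_self,
      if_true, if_false, mul_zero, zero_mul]

lemma weight_union_of_conflict {S T : Finset α} (hd : Disjoint S T) {a b : α}
    (ha : a ∈ S) (hb : b ∈ T) (h : R a b) : weight R lam (S ∪ T) = 0 := by
  unfold weight
  refine if_neg fun H => H ?_ ?_ ?_ h
  · simp [ha]
  · simp [hb]
  · rintro rfl
    exact disjoint_left.1 hd ha hb

lemma partitionFn_insert_le (hl : 0 ≤ lam) {a : α} {A : Finset α} (ha : a ∉ A) :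
    partitionFn R lam (insert a A) ≤ (1 + lam) * partitionFn R lam A := by
  unfold partitionFn
  rw [sum_powerset_insert ha, add_mul, one_mul, mul_sum]
  gcongr with S hS
  exact weight_insert_le hl fun h => ha (mem_powerset.1 hS h)

lemma partitionFn_union_le (hl : 0 ≤ lam) (A C : Finset α) :
    partitionFn R lam (A ∪ C) ≤ (1 + lam) ^ #C * partitionFn R lam A := by
  induction C using Finset.induction_on with
  | empty => simp
  | insert a C ha ih =>
    have h1 : 1 ≤ 1 + lam := by linarith
    rw [card_insert_of_notMem ha, union_insert]
    by_cases h : a ∈ A ∪ C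
    · rw [insert_eq_of_mem h]
      refine ih.trans ?_
      have := partitionFn_nonneg (R := R) hl A
      gcongr
      omega
    · refine (partitionFn_insert_le hl h).trans ?_
      rw [pow_succ', mul_assoc]
      gcongr

lemma partitionFn_le_exp (hl : 0 ≤ lam) (A : Finset α) :
    partitionFn R lam A ≤ Real.exp (lam * #A) := by
  have h := partitionFn_union_le (R := R) hl ∅ A
  have h0 : partitionFn R lam (∅ : Finset α) = 1 := by simp [partitionFn, weight_empty]
  rw [empty_union, h0, mul_one] at h
  refine h.trans ?_
  rw [mul_comm, Real.exp_nat_mul]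
  gcongr
  linarith [Real.add_one_le_exp lam]

/-- The sets containing `u` have total weight at least `lam` times the partition function on the
elements not in conflict with `u`, hence at least `lam * (1 - lam * k)` times the whole, where `k`
counts the elements in conflict with `u`. -/
lemma mul_partitionFn_le_sum_mem [DecidableRel R] (hl : 0 ≤ lam) (hs : ∀ a b, R a b → R b a)
    {A : Finset α} {u : α} (hu : u ∈ A) (hr : R u u) :
    lam * (1 - lam * #{b ∈ A | R u b}) * partitionFn R lam A ≤
      ∑ S ∈ A.powerset, if u ∈ S then weight R lam S else 0 := by
  set B := {b ∈ A | ¬ R u b} with hB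
  set C := {b ∈ A | R u b} with hC
  have hAu : B ∪ C = A := by rw [union_comm]; exact filter_union_filter_not_eq _ _
  have huB : u ∉ B := by simp [hB, hr]
  have h1 : lam * partitionFn R lam B ≤ ∑ S ∈ A.powerset, if u ∈ S then weight R lam S else 0 := by
    have hsub : (insert u B).powerset ⊆ A.powerset :=
      powerset_mono.2 (insert_subset hu (filter_subset _ _))
    calc lam * partitionFn R lam B
        = ∑ S ∈ B.powerset, weight R lam ({u} ∪ S) := by
          rw [partitionFn, mul_sum]
          refine sum_congr rfl fun S hS => ?_
          have hS := mem_powerset.1 hS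
          rw [weight_union hs (by simpa using fun h => huB (hS h))]
          · simp [weight]
          · intro a ha b hb
            rw [mem_singleton] at ha
            subst ha
            exact (mem_filter.1 (hS hb)).2
      _ ≤ ∑ S ∈ (insert u B).powerset, if u ∈ S then weight R lam S else 0 := by
          rw [sum_powerset_insert huB]
          refine le_add_of_nonneg_of_le ?_ (le_of_eq ?_)
          · exact sum_nonneg fun S _ => by split_ifs; exacts [weight_nonneg hl S, le_rfl]
          · exact sum_congr rfl fun S _ => by simp
      _ ≤ _ := sum_le_sum_of_subset_of_nonneg hsub fun S _ _ => by
          split_ifs; exacts [weight_nonneg hl S, le_rfl]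
  refine le_trans ?_ h1
  rw [mul_assoc]
  gcongr
  have h2 := partitionFn_union_le (R := R) hl B C
  rw [hAu] at h2
  have hZ := partitionFn_nonneg (R := R) hl B
  have hZA := partitionFn_nonneg (R := R) hl A
  have h3 : (1 + lam) ^ #C ≤ Real.exp (lam * #C) := by
    rw [mul_comm, Real.exp_nat_mul]
    gcongr
    linarith [Real.add_one_le_exp lam]
  have h4 : 1 - lam * #C ≤ Real.exp (-(lam * #C)) := by
    linarith [Real.add_one_le_exp (-(lam * #C))]
  calc (1 - lam * #C) * partitionFn R lam A
      ≤ Real.exp (-(lam * #C)) * (Real.exp (lam * #C) * partitionFn R lam B) := by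
        gcongr
        exact h2.trans (by gcongr)
    _ = partitionFn R lam B := by
        rw [← mul_assoc, ← Real.exp_add]; simp

/-- A lower bound for the total size of the independent subsets of `A`, useful when the conflict
graph on `A` is sparse. -/
lemma mul_partitionFn_le_sum_card [DecidableRel R] (hl : 0 ≤ lam)
    (hs : ∀ a b, R a b → R b a) (A : Finset α) (hr : ∀ a ∈ A, R a a) :
    lam * (#A - lam * #{p ∈ A ×ˢ A | R p.1 p.2}) * partitionFn R lam A ≤
      ∑ S ∈ A.powerset, #S * weight R lam S := by
  have h1 : ∑ S ∈ A.powerset, (#S : ℝ) * weight R lam S =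
      ∑ u ∈ A, ∑ S ∈ A.powerset, if u ∈ S then weight R lam S else 0 := by
    rw [sum_comm]
    refine sum_congr rfl fun S hS => ?_
    rw [← sum_filter, sum_const, nsmul_eq_mul, filter_mem_eq_inter,
      inter_eq_right.2 (mem_powerset.1 hS)]
  have h2 : (#{p ∈ A ×ˢ A | R p.1 p.2} : ℝ) = ∑ u ∈ A, (#{b ∈ A | R u b} : ℝ) := by
    simp only [card_filter, sum_product, Nat.cast_sum]
  rw [h1, h2]
  refine le_trans (le_of_eq ?_) (sum_le_sum fun u hu => mul_partitionFn_le_sum_mem hl hs hu (hr u hu))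
  rw [← sum_mul, ← mul_sum, sum_sub_distrib, ← mul_sum]
  simp

/-- If `A` is small, then its partition function is so small that the single set `{v}` carries
enough weight; if `A` is large, then by sparsity its independent subsets are large on average. -/
lemma le_sum_weight_of_sparse [DecidableRel R] (hl : 0 ≤ lam)
    (hs : ∀ a b, R a b → R b a) {K T l : ℝ} (hK : 0 ≤ K) (hT : lam ^ 2 * T ≤ l / 2)
    (hKl : l / 2 * Real.exp l ≤ K * lam) (h0 : 0 ≤ l)
    {A : Finset α} (hr : ∀ a ∈ A, R a a) {v : α} (hv : v ∈ A)
    (hA : (#{p ∈ A ×ˢ A | R p.1 p.2} : ℝ) ≤ T) :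
    l / 2 * partitionFn R lam A ≤
      ∑ S ∈ A.powerset, (K * (if v ∈ S then 1 else 0) + #S) * weight R lam S := by
  have hZ := partitionFn_nonneg (R := R) hl A
  -- The two cases compare `#A` with the threshold `l / lam`.
  rcases le_total (lam * #A) l with h | h
  · calc l / 2 * partitionFn R lam A ≤ l / 2 * Real.exp l := by
          gcongr
          exact (partitionFn_le_exp hl A).trans (Real.exp_le_exp.2 h)
      _ ≤ K * lam := hKl
      _ ≤ (K * (if v ∈ ({v} : Finset α) then 1 else 0) + #({v} : Finset α)) *
            weight R lam {v} := by
          simp [weight]; nlinarith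
      _ ≤ _ := single_le_sum
          (f := fun S : Finset α => (K * (if v ∈ S then 1 else 0) + #S) * weight R lam S)
          (fun S _ => mul_nonneg (by split_ifs <;> positivity) (weight_nonneg hl S))
          (by simpa using hv)
  · calc l / 2 * partitionFn R lam A
        ≤ lam * (#A - lam * #{p ∈ A ×ˢ A | R p.1 p.2}) * partitionFn R lam A := by
          gcongr
          have : lam ^ 2 * (#{p ∈ A ×ˢ A | R p.1 p.2} : ℝ) ≤ lam ^ 2 * T := by gcongr
          nlinarith
      _ ≤ ∑ S ∈ A.powerset, #S * weight R lam S := mul_partitionFn_le_sum_card hl hs A hr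
      _ ≤ _ := by
          refine sum_le_sum fun S _ => ?_
          have := weight_nonneg (R := R) hl S
          gcongr
          split_ifs <;> simp [hK]

lemma sum_powerset_union {β : Type*} [AddCommMonoid β] {A C : Finset α} (h : Disjoint A C)
    (f : Finset α → β) :
    ∑ S ∈ (A ∪ C).powerset, f S = ∑ J ∈ A.powerset, ∑ S ∈ C.powerset, f (J ∪ S) := by
  induction C using Finset.induction_on generalizing f with
  | empty => simp
  | insert a C ha ih =>
    obtain ⟨h1, h2⟩ := disjoint_insert_right.1 h
    rw [union_insert, sum_powerset_insert (by simp [ha, h1]), ih h2, ih h2, ← sum_add_distrib]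
    refine sum_congr rfl fun J _ => ?_
    rw [sum_powerset_insert ha]
    simp [union_insert]

/-- Local occupancy: condition on the part of a random independent set outside the closed
neighbourhood of `v` and apply `le_sum_weight_of_sparse` to what is left available. -/
lemma le_sum_weight_closedNbhd [DecidableRel R] (hl : 0 ≤ lam)
    (hs : ∀ a b, R a b → R b a) {K T l : ℝ} (hK : 0 ≤ K) (hT : lam ^ 2 * T ≤ l / 2)
    (hKl : l / 2 * Real.exp l ≤ K * lam) (h0 : 0 ≤ l)
    {U : Finset α} (hr : ∀ a ∈ U, R a a) {v : α} (hv : v ∈ U)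
    (hU : (#{p ∈ U ×ˢ U | R v p.1 ∧ R v p.2 ∧ R p.1 p.2} : ℝ) ≤ T) :
    l / 2 * partitionFn R lam U ≤
      ∑ S ∈ U.powerset, (K * (if v ∈ S then 1 else 0) + #{b ∈ S | R v b}) * weight R lam S := by
  set C := {b ∈ U | R v b} with hC
  set B := {b ∈ U | ¬ R v b} with hB
  have hU' : U = B ∪ C := by rw [union_comm]; exact (filter_union_filter_not_eq _ _).symm
  have hBC : Disjoint B C := (disjoint_filter_filter_not _ _ _).symm
  have hvC : v ∈ C := by simp [hC, hv, hr v hv]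
  have hvB : v ∉ B := by simp [hB, hr v hv]
  rw [partitionFn, hU', sum_powerset_union hBC, sum_powerset_union hBC, mul_sum]
  refine sum_le_sum fun J hJ => ?_
  have hJ := mem_powerset.1 hJ
  -- The elements of the closed neighbourhood that are still available given `J`. As `J` avoids that
  -- neighbourhood, `v` is one of them.
  set A := {b ∈ C | ∀ j ∈ J, ¬ R j b} with hAdef
  have hAC : A ⊆ C := filter_subset _ _
  have hvA : v ∈ A :=
    mem_filter.2 ⟨hvC, fun j hj hjv => (mem_filter.1 (hJ hj)).2 (hs _ _ hjv)⟩
  have hdis : ∀ S ⊆ C, Disjoint J S := fun S hS => hBC.mono hJ hS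
  have hzero : ∀ S ∈ C.powerset, S ∉ A.powerset → weight R lam (J ∪ S) = 0 := by
    intro S hS hSA
    have hS := mem_powerset.1 hS
    obtain ⟨b, hb, hbA⟩ := not_subset.1 (fun h => hSA (mem_powerset.2 h))
    have : ∃ j ∈ J, R j b := by
      by_contra! hcon
      exact hbA (mem_filter.2 ⟨hS hb, hcon⟩)
    obtain ⟨j, hj, hjb⟩ := this
    exact weight_union_of_conflict (hdis S hS) hj hb hjb
  have hprod : ∀ S ∈ A.powerset, weight R lam (J ∪ S) = weight R lam J * weight R lam S := by
    intro S hS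
    have hS := mem_powerset.1 hS
    exact weight_union hs (hdis S (hS.trans hAC)) fun a ha b hb =>
      (mem_filter.1 (hS hb)).2 a ha
  rw [← sum_subset (powerset_mono.2 hAC) hzero,
    ← sum_subset (powerset_mono.2 hAC) (fun S hS hSA => by rw [hzero S hS hSA, mul_zero]),
    sum_congr rfl hprod, ← mul_sum]
  have key := le_sum_weight_of_sparse hl hs hK hT hKl h0
    (fun a ha => hr a (mem_filter.1 (hAC ha)).1) hvA (le_trans (by
    gcongr
    intro p hp
    simp only [mem_filter, mem_product] at hp ⊢
    have h1 := mem_filter.1 (hAC hp.1.1)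
    have h2 := mem_filter.1 (hAC hp.1.2)
    exact ⟨⟨h1.1, h2.1⟩, h1.2, h2.2, hp.2⟩) hU)
  calc l / 2 * (weight R lam J * ∑ S ∈ A.powerset, weight R lam S)
      = weight R lam J * (l / 2 * partitionFn R lam A) := by rw [partitionFn]; ring
    _ ≤ weight R lam J *
          ∑ S ∈ A.powerset, (K * (if v ∈ S then 1 else 0) + #S) * weight R lam S := by
        gcongr
        exact weight_nonneg hl J
    _ = _ := by
        rw [mul_sum]
        refine sum_congr rfl fun S hS => ?_
        rw [hprod S hS]
        have hS := (mem_powerset.1 hS).trans hAC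
        have e1 : (v ∈ J ∪ S) ↔ v ∈ S := by
          rw [mem_union]
          exact or_iff_right fun h => hvB (hJ h)
        have e2 : {b ∈ J ∪ S | R v b} = S := by
          ext b
          simp only [mem_filter, mem_union]
          refine ⟨fun h => h.1.resolve_left fun hb => (mem_filter.1 (hJ hb)).2 h.2,
            fun h => ⟨Or.inr h, (mem_filter.1 (hS h)).2⟩⟩
        simp only [e1, e2]
        ring

/-- A large independent set in a conflict graph whose closed neighbourhoods are sparse: the average
over the hard-core model of `(K + D) * #S` is at least `l / 2 * #U`. -/
theorem exists_independent_of_sparse [DecidableRel R] (hl : 0 ≤ lam)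
    (hs : ∀ a b, R a b → R b a) {K D T l : ℝ} (hK : 0 ≤ K) (hT : lam ^ 2 * T ≤ l / 2)
    (hKl : l / 2 * Real.exp l ≤ K * lam) (h0 : 0 ≤ l) (U : Finset α)
    (hr : ∀ a ∈ U, R a a)
    (hD : ∀ v ∈ U, (#{b ∈ U | R v b} : ℝ) ≤ D)
    (hU : ∀ v ∈ U, (#{p ∈ U ×ˢ U | R v p.1 ∧ R v p.2 ∧ R p.1 p.2} : ℝ) ≤ T) :
    ∃ S ⊆ U, (S : Set α).Pairwise (fun a b => ¬ R a b) ∧ l / 2 * #U ≤ (K + D) * #S := by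
  have h1 := sum_le_sum fun v hv => le_sum_weight_closedNbhd hl hs hK hT hKl h0 hr hv (hU v hv)
  rw [sum_comm, sum_const, nsmul_eq_mul] at h1
  have h2 : ∀ S ∈ U.powerset,
      ∑ v ∈ U, (K * (if v ∈ S then 1 else 0) + #{b ∈ S | R v b}) * weight R lam S ≤
        (K + D) * #S * weight R lam S := by
    intro S hS
    have hSU := mem_powerset.1 hS
    rw [← sum_mul]
    refine mul_le_mul_of_nonneg_right ?_ (weight_nonneg hl S)
    rw [sum_add_distrib, ← mul_sum, add_mul]
    have e1 : ∑ v ∈ U, (if v ∈ S then (1 : ℝ) else 0) = #S := by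
      rw [sum_boole, filter_mem_eq_inter, inter_eq_right.2 hSU]
    have e2 : ∑ v ∈ U, (#{b ∈ S | R v b} : ℝ) ≤ D * #S := by
      calc ∑ v ∈ U, (#{b ∈ S | R v b} : ℝ) = ∑ b ∈ S, (#{v ∈ U | R b v} : ℝ) := by
            simp only [card_filter, Nat.cast_sum]
            rw [sum_comm]
            refine sum_congr rfl fun b _ => sum_congr rfl fun v _ => ?_
            rw [if_congr ⟨hs v b, hs b v⟩ rfl rfl]
        _ ≤ ∑ _b ∈ S, D := sum_le_sum fun b hb => hD b (hSU hb)
        _ = D * #S := by rw [sum_const, nsmul_eq_mul, mul_comm]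
    rw [e1]
    gcongr
  have h3 := h1.trans (sum_le_sum h2)
  by_contra! hcon
  have h4 : ∑ S ∈ U.powerset, (K + D) * #S * weight R lam S <
      ∑ S ∈ U.powerset, l / 2 * #U * weight R lam S := by
    refine sum_lt_sum (fun S hS => ?_) ⟨∅, empty_mem_powerset _, ?_⟩
    · by_cases h : (S : Set α).Pairwise (fun a b => ¬ R a b)
      · exact mul_le_mul_of_nonneg_right (hcon S (mem_powerset.1 hS) h).le (weight_nonneg hl S)
      · simp [weight, h]
    · rw [weight_empty, mul_one, mul_one]
      exact hcon ∅ (empty_subset _) (by simp)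
  rw [← mul_sum] at h4
  simp only [partitionFn] at h3
  linarith

end HardCore

/-! ### Edges between two sets in a graph without `K_{t,t}` -/

section KST

/-- A lower bound for binomial coefficients; the last term covers `n < t`. -/
lemma pow_le_mul_choose (n t : ℕ) : n ^ t ≤ t ^ t * (t.factorial * n.choose t) + t ^ t := by
  rcases le_total n t with h | h
  · exact (Nat.pow_le_pow_left h t).trans (Nat.le_add_left _ _)
  · rcases Nat.eq_zero_or_pos t with rfl | ht
    · simp
    refine le_trans ?_ (Nat.le_add_right _ _)
    have h1 : n ≤ t * (n + 1 - t) := by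
      obtain ⟨k, rfl⟩ := Nat.exists_eq_add_of_le h
      have : t + k + 1 - t = k + 1 := by omega
      rw [this]
      nlinarith
    rw [← Nat.descFactorial_eq_factorial_mul_choose]
    calc n ^ t ≤ (t * (n + 1 - t)) ^ t := Nat.pow_le_pow_left h1 t
      _ = t ^ t * (n + 1 - t) ^ t := mul_pow _ _ _
      _ ≤ _ := Nat.mul_le_mul_left _ (Nat.pow_sub_le_descFactorial n t)

variable {V : Type*} {G : SimpleGraph V} [DecidableRel G.Adj]

/-- Double counting of stars: a `t`-subset of `X` has fewer than `t` common neighbours in `Y`. -/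
lemma sum_choose_le {t : ℕ}
    (hfree : ∀ x y : Fin t → V, x.Injective → y.Injective → ∃ i j, ¬ G.Adj (x i) (y j))
    (X Y : Finset V) :
    ∑ y ∈ Y, (#{x ∈ X | G.Adj x y}).choose t ≤ t * (#X).choose t := by
  classical
  calc ∑ y ∈ Y, (#{x ∈ X | G.Adj x y}).choose t
      = ∑ y ∈ Y, #{S ∈ powersetCard t X | ∀ x ∈ S, G.Adj x y} := by
        refine sum_congr rfl fun y _ => ?_
        rw [← card_powersetCard]
        congr 1
        ext S
        simp only [mem_powersetCard, mem_filter, subset_iff]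
        grind
    _ = ∑ S ∈ powersetCard t X, #{y ∈ Y | ∀ x ∈ S, G.Adj x y} :=
        sum_card_bipartiteAbove_eq_sum_card_bipartiteBelow (fun y S => ∀ x ∈ S, G.Adj x y)
    _ ≤ ∑ _S ∈ powersetCard t X, t := by
        refine sum_le_sum fun S hS => ?_
        by_contra! hcon
        obtain ⟨Y', hY', hc⟩ := exists_subset_card_eq hcon.le
        have hSt := (mem_powersetCard.1 hS).2
        let x := (S.equivFinOfCardEq hSt).symm
        let y := (Y'.equivFinOfCardEq hc).symm
        obtain ⟨i, j, hij⟩ := hfree (fun i => (x i : V)) (fun i => (y i : V))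
          (Subtype.val_injective.comp x.injective) (Subtype.val_injective.comp y.injective)
        exact hij ((mem_filter.1 (hY' (y j).2)).2 _ (x i).2)
    _ = t * (#X).choose t := by rw [sum_const, card_powersetCard, smul_eq_mul, mul_comm]

/-- A Kővári–Sós–Turán bound for the number of edges between two vertex sets of size at most `m`,
which need not be disjoint, in a graph without `K_{t,t}`. -/
theorem sum_adj_le {t : ℕ} (ht : 0 < t)
    (hfree : ∀ x y : Fin t → V, x.Injective → y.Injective → ∃ i j, ¬ G.Adj (x i) (y j))
    {X Y : Finset V} {m : ℕ} (hm : 1 ≤ m) (hX : #X ≤ m) (hY : #Y ≤ m) :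
    ∑ x ∈ X, ∑ y ∈ Y, (if G.Adj x y then (1 : ℝ) else 0) ≤
      ((t ^ t * (t + 1) : ℕ) : ℝ) * (m : ℝ) ^ (2 - 1 / (t : ℝ)) := by
  set C : ℕ := t ^ t * (t + 1) with hC
  have hm0 : (0 : ℝ) < m := by exact_mod_cast hm
  have hC1 : (1 : ℝ) ≤ C := by
    have : 0 < C := by positivity
    exact_mod_cast this
  set f : V → ℝ := fun y => (#{x ∈ X | G.Adj x y} : ℝ) with hf
  have h0 : ∑ x ∈ X, ∑ y ∈ Y, (if G.Adj x y then (1 : ℝ) else 0) = ∑ y ∈ Y, f y := by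
    rw [sum_comm]
    exact sum_congr rfl fun y _ => by rw [sum_boole]
  have h1 : ∑ y ∈ Y, f y ^ t ≤ C * (m : ℝ) ^ t := by
    have h2 : ∑ y ∈ Y, (#{x ∈ X | G.Adj x y}) ^ t ≤ C * m ^ t := by
      calc ∑ y ∈ Y, (#{x ∈ X | G.Adj x y}) ^ t
          ≤ ∑ y ∈ Y, (t ^ t * (t.factorial * (#{x ∈ X | G.Adj x y}).choose t) + t ^ t) :=
            sum_le_sum fun y _ => pow_le_mul_choose _ _
        _ = t ^ t * (t.factorial * ∑ y ∈ Y, (#{x ∈ X | G.Adj x y}).choose t) + #Y * t ^ t := by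
            rw [sum_add_distrib, ← mul_sum, ← mul_sum, sum_const, smul_eq_mul]
        _ ≤ t ^ t * (t.factorial * (t * m.choose t)) + m ^ t * t ^ t := by
            gcongr
            · exact (sum_choose_le hfree X Y).trans
                (Nat.mul_le_mul_left _ (Nat.choose_le_choose t hX))
            · exact hY.trans (Nat.le_self_pow ht.ne' m)
        _ = t ^ t * (t * m.descFactorial t) + m ^ t * t ^ t := by
            rw [Nat.descFactorial_eq_factorial_mul_choose]; ring
        _ ≤ t ^ t * (t * m ^ t) + m ^ t * t ^ t := by
            gcongr
            exact Nat.descFactorial_le_pow m t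
        _ = C * m ^ t := by rw [hC]; ring
    simp only [hf]
    exact_mod_cast h2
  obtain ⟨k, rfl⟩ : ∃ k, t = k + 1 := ⟨t - 1, by omega⟩
  -- Power mean inequality over `Y`.
  have h3 : (∑ y ∈ Y, f y) ^ (k + 1) ≤ (m : ℝ) ^ k * (C * (m : ℝ) ^ (k + 1)) := by
    rcases Y.eq_empty_or_nonempty with rfl | hne
    · simp; positivity
    have h4 := pow_sum_div_card_le_sum_pow (s := Y) (f := f) (fun y _ => by positivity) k
    have hY0 : (0 : ℝ) < #Y := by exact_mod_cast hne.card_pos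
    rw [div_le_iff₀ (by positivity)] at h4
    calc _ ≤ _ := h4
      _ ≤ (C * (m : ℝ) ^ (k + 1)) * (m : ℝ) ^ k := by gcongr
      _ = _ := mul_comm _ _
  rw [h0]
  refine le_of_pow_le_pow_left₀ (n := k + 1) (by omega) (by positivity) (h3.trans ?_)
  rw [mul_pow, ← Real.rpow_natCast ((m : ℝ) ^ _), ← Real.rpow_mul hm0.le]
  have h5 : (2 - 1 / ((k + 1 : ℕ) : ℝ)) * ((k + 1 : ℕ) : ℝ) = ((k + (k + 1) : ℕ) : ℝ) := by
    field_simp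
    push_cast
    ring
  rw [h5, Real.rpow_natCast, pow_add (m : ℝ) k (k + 1), mul_left_comm]
  gcongr
  exact le_self_pow₀ hC1 (by omega)

end KST

/-! ### Conflicts between darts -/

section Darts

variable {V : Type*} {G : SimpleGraph V}

/-- Two darts are in conflict if some endpoint of one is adjacent to some endpoint of the other.
A dart is in conflict with itself and with its reverse, and so are any two darts that share an
endpoint. -/
def Conflict (G : SimpleGraph V) (a b : V × V) : Prop :=
  (G.Adj a.1 b.1 ∨ G.Adj a.1 b.2) ∨ (G.Adj a.2 b.1 ∨ G.Adj a.2 b.2)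

instance [DecidableRel G.Adj] : DecidableRel (Conflict G) := fun a b => by
  unfold Conflict; infer_instance

lemma conflict_self {a : V × V} (h : G.Adj a.1 a.2) : Conflict G a a := Or.inl (Or.inr h)

lemma Conflict.symm {a b : V × V} (h : Conflict G a b) : Conflict G b a := by
  unfold Conflict at *
  simp only [G.adj_comm b.1, G.adj_comm b.2]
  tauto

lemma conflict_swap_left {a b : V × V} : Conflict G a.swap b ↔ Conflict G a b := by
  simp only [Conflict, Prod.fst_swap, Prod.snd_swap]; tauto

lemma conflict_swap_right {a b : V × V} : Conflict G a b.swap ↔ Conflict G a b := by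
  simp only [Conflict, Prod.fst_swap, Prod.snd_swap]; tauto

/-- An independent set of darts, with orientations forgotten, is an induced matching. -/
theorem exists_isInducedMatching_of_pairwise (S : Finset (V × V))
    (hS : ∀ a ∈ S, G.Adj a.1 a.2)
    (hi : (S : Set (V × V)).Pairwise (fun a b => ¬ Conflict G a b)) :
    ∃ M : G.Subgraph, M.IsInducedMatching ∧ #S ≤ M.edgeSet.ncard := by
  classical
  have hi' : ∀ a ∈ S, ∀ b ∈ S, Conflict G a b → a = b := fun a ha b hb h => by
    by_contra hne
    exact hi ha hb hne h
  let M : G.Subgraph :=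
    { verts := {x | ∃ y, (x, y) ∈ S ∨ (y, x) ∈ S}
      Adj := fun x y => (x, y) ∈ S ∨ (y, x) ∈ S
      adj_sub := by
        rintro x y (h | h)
        · exact hS _ h
        · exact (hS _ h).symm
      edge_vert := fun {x y} h => ⟨y, h⟩
      symm := ⟨fun x y h => h.symm⟩ }
  have hE : M.edgeSet = (fun a : V × V => s(a.1, a.2)) '' (S : Set (V × V)) := by
    ext e
    induction e with
    | h x y =>
      rw [SimpleGraph.Subgraph.mem_edgeSet]
      constructor
      · rintro (h | h)
        · exact ⟨_, h, rfl⟩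
        · exact ⟨_, h, Sym2.eq_swap⟩
      · rintro ⟨⟨a, b⟩, h, hab⟩
        rcases Sym2.eq_iff.1 hab with ⟨rfl, rfl⟩ | ⟨rfl, rfl⟩
        · exact Or.inl h
        · exact Or.inr h
  have hconf : ∀ a b : V × V, ∀ u ∈ s(a.1, a.2), ∀ v ∈ s(b.1, b.2), G.Adj u v →
      Conflict G a b := by
    intro a b u hu v hv huv
    unfold Conflict
    rcases Sym2.mem_iff.1 hu with rfl | rfl <;> rcases Sym2.mem_iff.1 hv with rfl | rfl <;> tauto
  refine ⟨M, ⟨?_, ?_⟩, ?_⟩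
  · rintro x ⟨y, hxy⟩
    refine ⟨y, hxy, fun z hxz => ?_⟩
    have key : ∀ a ∈ S, ∀ b ∈ S, s(a.1, a.2) = s(x, z) → s(b.1, b.2) = s(x, y) → z = y := by
      intro a ha b hb h1 h2
      have hadj : G.Adj x y := by
        have : s(b.1, b.2) ∈ G.edgeSet := hS b hb
        rwa [h2] at this
      have : a = b := hi' a ha b hb
        (hconf a b x (h1 ▸ Sym2.mem_mk_left _ _) y (h2 ▸ Sym2.mem_mk_right _ _) hadj)
      rw [this, h2] at h1
      exact (Sym2.congr_right.1 h1).symm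
    rcases hxz with h | h <;> rcases hxy with h' | h'
    · exact key _ h _ h' rfl rfl
    · exact key _ h _ h' rfl Sym2.eq_swap
    · exact key _ h _ h' Sym2.eq_swap rfl
    · exact key _ h _ h' Sym2.eq_swap Sym2.eq_swap
  · rw [hE]
    rintro _ ⟨a, ha, rfl⟩ _ ⟨b, hb, rfl⟩ hne u hu v hv huv
    exact hne (by rw [hi' a ha b hb (hconf a b u hu v hv huv)])
  · rw [hE, Set.InjOn.ncard_image, Set.ncard_coe_finset]
    intro a ha b hb (hab : s(a.1, a.2) = s(b.1, b.2))
    refine hi' a ha b hb (hconf a b a.1 (Sym2.mem_mk_left _ _) a.2 ?_ (hS a ha))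
    exact hab ▸ Sym2.mem_mk_right _ _

variable [Fintype V] [DecidableRel G.Adj] {d : ℕ}

/-- The darts of `G`, as ordered pairs of adjacent vertices. -/
def darts (G : SimpleGraph V) [DecidableRel G.Adj] : Finset (V × V) := {a | G.Adj a.1 a.2}

/-- The darts of `G` whose first endpoint is adjacent to `p`. -/
def dartsNear (G : SimpleGraph V) [DecidableRel G.Adj] (p : V) : Finset (V × V) :=
  {b | G.Adj p b.1 ∧ G.Adj b.1 b.2}

lemma sum_dartsNear {β : Type*} [AddCommMonoid β] (p : V) (g : V × V → β) :
    ∑ b ∈ dartsNear G p, g b =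
      ∑ x ∈ G.neighborFinset p, ∑ y ∈ G.neighborFinset x, g (x, y) :=
  sum_finset_product _ _ _ (by simp [dartsNear])

lemma card_dartsNear (hG : G.IsRegularOfDegree d) (p : V) : #(dartsNear G p) = d * d := by
  rw [card_eq_sum_ones, sum_dartsNear]
  simp [hG.degree_eq]

lemma card_darts (hG : G.IsRegularOfDegree d) : #(darts G) = Fintype.card V * d := by
  rw [card_eq_sum_ones, sum_finset_product (darts G) univ (fun x => G.neighborFinset x)
    (by simp [darts])]
  simp [hG.degree_eq]

/-- If the neighbourhoods of any two vertices span few edges between them, then few pairs of darts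
near `p` and `p'` are in conflict: each of the four kinds of adjacency leaves the choice of two
further endpoints, in `d` ways each. -/
lemma card_conflict_dartsNear_le (hG : G.IsRegularOfDegree d) {Q : ℝ}
    (hQ : ∀ p q, ∑ x ∈ G.neighborFinset p, ∑ y ∈ G.neighborFinset q,
      (if G.Adj x y then (1 : ℝ) else 0) ≤ Q) (p p' : V) :
    (#{q ∈ dartsNear G p ×ˢ dartsNear G p' | Conflict G q.1 q.2} : ℝ) ≤ 4 * (d ^ 2 * Q) := by
  obtain ⟨f, hf⟩ : ∃ f : V → V → ℝ, ∀ u v, f u v = if G.Adj u v then 1 else 0 :=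
    ⟨fun u v => if G.Adj u v then 1 else 0, fun _ _ => rfl⟩
  simp only [← hf] at hQ
  have hle : ∀ b c : V × V, (if Conflict G b c then (1 : ℝ) else 0) ≤
      f b.1 c.1 + f b.1 c.2 +
        f b.2 c.1 + f b.2 c.2 := by
    intro b c
    simp only [hf]
    unfold Conflict
    by_cases h1 : G.Adj b.1 c.1 <;> by_cases h2 : G.Adj b.1 c.2 <;>
      by_cases h3 : G.Adj b.2 c.1 <;> by_cases h4 : G.Adj b.2 c.2 <;> simp [h1, h2, h3, h4] <;> norm_num
  have hN : ∀ v, (#(G.neighborFinset v) : ℝ) = d := fun v => by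
    rw [G.card_neighborFinset_eq_degree, hG.degree_eq]
  have h11 : ∑ b ∈ dartsNear G p, ∑ c ∈ dartsNear G p', f b.1 c.1 ≤
      d ^ 2 * Q := by
    simp only [sum_dartsNear, sum_const, nsmul_eq_mul, hN, ← mul_sum]
    rw [← mul_assoc, ← sq]
    exact mul_le_mul_of_nonneg_left (hQ p p') (by positivity)
  have h12 : ∑ b ∈ dartsNear G p, ∑ c ∈ dartsNear G p', f b.1 c.2 ≤
      d ^ 2 * Q := by
    simp only [sum_dartsNear, sum_const, nsmul_eq_mul, hN, ← mul_sum]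
    rw [sum_comm]
    calc _ ≤ (d : ℝ) * ∑ x' ∈ G.neighborFinset p', Q := by
          gcongr with x' hx'
          exact hQ p x'
      _ = d ^ 2 * Q := by rw [sum_const, nsmul_eq_mul, hN]; ring
  have h21 : ∑ b ∈ dartsNear G p, ∑ c ∈ dartsNear G p', f b.2 c.1 ≤
      d ^ 2 * Q := by
    simp only [sum_dartsNear, sum_const, nsmul_eq_mul, hN, ← mul_sum]
    calc _ ≤ (d : ℝ) * ∑ x ∈ G.neighborFinset p, Q := by
          gcongr with x hx
          exact hQ x p'
      _ = d ^ 2 * Q := by rw [sum_const, nsmul_eq_mul, hN]; ring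
  have h22 : ∑ b ∈ dartsNear G p, ∑ c ∈ dartsNear G p', f b.2 c.2 ≤
      d ^ 2 * Q := by
    simp only [sum_dartsNear]
    calc _ ≤ ∑ x ∈ G.neighborFinset p, ∑ x' ∈ G.neighborFinset p', Q := by
          gcongr with x hx
          rw [sum_comm]
          gcongr with x' hx'
          exact hQ x x'
      _ = d ^ 2 * Q := by simp only [sum_const, nsmul_eq_mul, hN]; ring
  rw [card_filter, Nat.cast_sum, sum_product]
  push_cast
  calc _ ≤ _ := sum_le_sum fun b _ => sum_le_sum fun c _ => hle b c
    _ ≤ 4 * (d ^ 2 * Q) := by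
      simp only [sum_add_distrib]
      linarith

variable [DecidableEq V]

/-- Labels for the ways in which a dart can be in conflict with `a`: which endpoint of `a` is
adjacent to it, and whether it has to be reversed for its first endpoint to be the adjacent one. -/
def conflictLabels (a : V × V) : Finset (V × (V × V → V × V)) :=
  {a.1, a.2} ×ˢ {id, Prod.swap}

lemma card_conflictLabels_le (a : V × V) : #(conflictLabels a) ≤ 4 := by
  rw [conflictLabels, card_product]
  exact Nat.mul_le_mul card_le_two card_le_two

lemma eq_id_or_swap_of_mem {a : V × V} {z : V × (V × V → V × V)} (hz : z ∈ conflictLabels a) :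
    z.2 = id ∨ z.2 = Prod.swap := by
  simpa using (mem_product.1 hz).2

lemma exists_mem_dartsNear {a b : V × V} (hb : b ∈ darts G) (h : Conflict G a b) :
    ∃ z ∈ conflictLabels a, ∃ b' ∈ dartsNear G z.1, z.2 b' = b := by
  have hb' : G.Adj b.1 b.2 := by simpa [darts] using hb
  rcases h with (h | h) | (h | h)
  · exact ⟨(a.1, id), by simp [conflictLabels], b, by simp [dartsNear, h, hb'], rfl⟩
  · exact ⟨(a.1, Prod.swap), by simp [conflictLabels], b.swap,
      by simp [dartsNear, h, hb'.symm], b.swap_swap⟩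
  · exact ⟨(a.2, id), by simp [conflictLabels], b, by simp [dartsNear, h, hb'], rfl⟩
  · exact ⟨(a.2, Prod.swap), by simp [conflictLabels], b.swap,
      by simp [dartsNear, h, hb'.symm], b.swap_swap⟩

lemma card_conflict_le (hG : G.IsRegularOfDegree d) (a : V × V) :
    #{b ∈ darts G | Conflict G a b} ≤ 4 * (d * d) := by
  have hsub : {b ∈ darts G | Conflict G a b} ⊆
      (conflictLabels a).biUnion fun z => (dartsNear G z.1).image z.2 := by
    intro b hb
    obtain ⟨hb, h⟩ := mem_filter.1 hb
    obtain ⟨z, hz, b', hb', e⟩ := exists_mem_dartsNear hb h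
    exact mem_biUnion.2 ⟨z, hz, mem_image.2 ⟨b', hb', e⟩⟩
  refine (card_le_card hsub).trans ((card_biUnion_le_card_mul _ _ (d * d) fun z _ => ?_).trans
    (Nat.mul_le_mul_right _ (card_conflictLabels_le a)))
  exact card_image_le.trans (card_dartsNear hG _).le

/-- Few pairs of darts in conflict with `a` are in conflict with each other. The factor `64` is `4`
for each of the `4 * 4` pairs of labels. -/
lemma card_conflict_pairs_le (hG : G.IsRegularOfDegree d) {Q : ℝ}
    (hQ : ∀ p q, ∑ x ∈ G.neighborFinset p, ∑ y ∈ G.neighborFinset q,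
      (if G.Adj x y then (1 : ℝ) else 0) ≤ Q) (a : V × V) :
    (#{q ∈ darts G ×ˢ darts G | Conflict G a q.1 ∧ Conflict G a q.2 ∧ Conflict G q.1 q.2} : ℝ) ≤
      64 * (d ^ 2 * Q) := by
  have hQ0 : 0 ≤ Q := (sum_nonneg fun x _ => sum_nonneg fun y _ => by
    split_ifs <;> norm_num).trans (hQ a.1 a.1)
  have hsub : {q ∈ darts G ×ˢ darts G | Conflict G a q.1 ∧ Conflict G a q.2 ∧ Conflict G q.1 q.2} ⊆
      (conflictLabels a ×ˢ conflictLabels a).biUnion fun z =>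
        {q ∈ dartsNear G z.1.1 ×ˢ dartsNear G z.2.1 | Conflict G q.1 q.2}.image
          (Prod.map z.1.2 z.2.2) := by
    rintro ⟨b, c⟩ hq
    simp only [mem_filter, mem_product] at hq
    obtain ⟨⟨hb, hc⟩, hab, hac, hbc⟩ := hq
    obtain ⟨z, hz, b', hb', rfl⟩ := exists_mem_dartsNear hb hab
    obtain ⟨w, hw, c', hc', rfl⟩ := exists_mem_dartsNear hc hac
    refine mem_biUnion.2 ⟨(z, w), mem_product.2 ⟨hz, hw⟩,
      mem_image.2 ⟨(b', c'), mem_filter.2 ⟨mem_product.2 ⟨hb', hc'⟩, ?_⟩, rfl⟩⟩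
    rcases eq_id_or_swap_of_mem hz with h | h <;> rcases eq_id_or_swap_of_mem hw with h' | h' <;>
      simpa [h, h', conflict_swap_left, conflict_swap_right] using hbc
  have hI : (#(conflictLabels a ×ˢ conflictLabels a) : ℝ) ≤ 16 := by
    have := Nat.mul_le_mul (card_conflictLabels_le a) (card_conflictLabels_le a)
    rw [← card_product] at this
    exact_mod_cast this
  calc _ ≤ (#((conflictLabels a ×ˢ conflictLabels a).biUnion fun z =>
        {q ∈ dartsNear G z.1.1 ×ˢ dartsNear G z.2.1 | Conflict G q.1 q.2}.image
          (Prod.map z.1.2 z.2.2)) : ℝ) := by exact_mod_cast card_le_card hsub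
    _ ≤ ∑ z ∈ conflictLabels a ×ˢ conflictLabels a,
          (#{q ∈ dartsNear G z.1.1 ×ˢ dartsNear G z.2.1 | Conflict G q.1 q.2} : ℝ) := by
        exact_mod_cast card_biUnion_le.trans (sum_le_sum fun z _ => card_image_le)
    _ ≤ ∑ z ∈ conflictLabels a ×ˢ conflictLabels a, 4 * (d ^ 2 * Q) :=
        sum_le_sum fun z _ => card_conflict_dartsNear_le hG hQ _ _
    _ ≤ 16 * (4 * (d ^ 2 * Q)) := by
        rw [sum_const, nsmul_eq_mul]
        gcongr
    _ = _ := by ring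

end Darts

/-! ### Induced matchings in regular graphs -/

/-- A graph with no copy of a bipartite graph on `B` vertices has no copy of `K_{B,B}`. -/
lemma exists_not_adj_of_free {W V : Type*} [Fintype W] {H : SimpleGraph W} {G : SimpleGraph V}
    (hH : H.IsBipartite) (hfree : H.Free G) (x y : Fin (Fintype.card W) → V)
    (hx : x.Injective) (hy : y.Injective) : ∃ i j, ¬ G.Adj (x i) (y j) := by
  by_contra! hadj
  obtain ⟨col⟩ := hH
  let e := Fintype.equivFin W
  let φ : W → V := fun w => if col w = 0 then x (e w) else y (e w)
  -- `φ` is injective because adjacent vertices differ, so the ranges of `x` and `y` are disjoint.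
  refine hfree ⟨⟨⟨φ, fun {a b} hab => ?_⟩, fun a b hab => ?_⟩⟩
  · have hne := col.valid hab
    by_cases ha : col a = 0 <;> by_cases hb : col b = 0
    · exact absurd (ha.trans hb.symm) hne
    · simpa [φ, ha, hb] using hadj _ _
    · simpa [φ, ha, hb] using (hadj _ _).symm
    · exact absurd (by omega) hne
  · change φ a = φ b at hab
    by_cases ha : col a = 0 <;> by_cases hb : col b = 0 <;>
      simp only [φ, ha, hb, if_true, if_false] at hab
    · exact e.injective (hx hab)
    · exact absurd hab (hadj _ _).ne
    · exact absurd hab (hadj _ _).ne'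
    · exact e.injective (hy hab)

/-- The bound for graphs without `K_{t,t}`, from `exists_independent_of_sparse` at fugacity
`d ^ (1 / (2 * t) - 2)`. -/
theorem exists_isInducedMatching_of_regular {t : ℕ} (ht : 0 < t) :
    ∃ c : ℝ, 0 < c ∧ ∀ (V : Type*) [Fintype V] (G : SimpleGraph V) [DecidableRel G.Adj] (d : ℕ),
      1 ≤ d → G.IsRegularOfDegree d →
      (∀ x y : Fin t → V, x.Injective → y.Injective → ∃ i j, ¬ G.Adj (x i) (y j)) →
      ∃ M : G.Subgraph, M.IsInducedMatching ∧
        c * (((Fintype.card V : ℝ) / (d : ℝ)) * Real.log (d : ℝ)) ≤ (M.edgeSet.ncard : ℝ) := by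
  have ht0 : (0 : ℝ) < t := by exact_mod_cast ht
  set δ : ℝ := 1 / (2 * t) with hδ
  have hδ0 : 0 < δ := by positivity
  have hδ1 : δ ≤ 1 := by
    have : (1 : ℝ) ≤ t := by exact_mod_cast ht
    rw [hδ, div_le_one (by positivity)]
    linarith
  set C : ℝ := ((t ^ t * (t + 1) : ℕ) : ℝ) with hC
  have hC0 : 0 ≤ C := by positivity
  set κ : ℝ := (64 * C + 1) * Real.exp (128 * C) with hκ
  have hκ0 : 0 < κ := by positivity
  refine ⟨δ / (4 * (κ + 4)), by positivity, ?_⟩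
  intro V _ G _ d hd hG hfree
  classical
  have hd1 : (1 : ℝ) ≤ d := by exact_mod_cast hd
  have hd0 : (0 : ℝ) < d := by linarith
  have hlog : 0 ≤ Real.log d := Real.log_nonneg hd1
  set Q : ℝ := C * (d : ℝ) ^ (2 - 2 * δ) with hQdef
  have hQ : ∀ p q, ∑ x ∈ G.neighborFinset p, ∑ y ∈ G.neighborFinset q,
      (if G.Adj x y then (1 : ℝ) else 0) ≤ Q := by
    intro p q
    have e : 2 * δ = 1 / (t : ℝ) := by rw [hδ]; field_simp
    rw [hQdef, e]
    exact sum_adj_le ht hfree hd (by simp [hG.degree_eq]) (by simp [hG.degree_eq])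
  -- The choice of `lam` makes `lam ^ 2` times the number of conflicting pairs equal to a constant.
  -- The additive constant `128 * C` in `l` absorbs it, so that no lower bound on `d` is needed.
  set lam : ℝ := (d : ℝ) ^ (δ - 2) with hlam
  set l : ℝ := 128 * C + δ / 2 * Real.log d with hl
  have hl0 : 0 ≤ l := by positivity
  have hT : lam ^ 2 * (64 * (d ^ 2 * Q)) ≤ l / 2 := by
    have e : lam ^ 2 * ((d : ℝ) ^ 2 * (d : ℝ) ^ (2 - 2 * δ)) = 1 := by
      rw [hlam, ← Real.rpow_natCast, ← Real.rpow_natCast, ← Real.rpow_mul hd0.le,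
        ← Real.rpow_add hd0, ← Real.rpow_add hd0]
      have : (δ - 2) * ((2 : ℕ) : ℝ) + (((2 : ℕ) : ℝ) + (2 - 2 * δ)) = 0 := by push_cast; ring
      rw [this, Real.rpow_zero]
    calc lam ^ 2 * (64 * (d ^ 2 * Q))
        = 64 * C * (lam ^ 2 * ((d : ℝ) ^ 2 * (d : ℝ) ^ (2 - 2 * δ))) := by rw [hQdef]; ring
      _ = 64 * C := by rw [e, mul_one]
      _ ≤ l / 2 := by
        have : 0 ≤ δ / 2 * Real.log d := by positivity
        linarith
  have hKl : l / 2 * Real.exp l ≤ κ * d ^ 2 * lam := by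
    have hdp : 1 ≤ (d : ℝ) ^ (δ / 2) := Real.one_le_rpow hd1 (by positivity)
    have e1 : Real.exp l = Real.exp (128 * C) * (d : ℝ) ^ (δ / 2) := by
      rw [hl, Real.exp_add, Real.rpow_def_of_pos hd0, mul_comm (Real.log _)]
    have e2 : l / 2 ≤ (64 * C + 1) * (d : ℝ) ^ (δ / 2) := by
      have h1 : δ / 2 * Real.log d ≤ (d : ℝ) ^ (δ / 2) := by
        rw [← Real.log_rpow hd0]
        exact Real.log_le_self (by positivity)
      nlinarith
    have e3 : (d : ℝ) ^ (δ / 2) * (d : ℝ) ^ (δ / 2) = d ^ 2 * lam := by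
      rw [hlam, ← Real.rpow_natCast, ← Real.rpow_add hd0, ← Real.rpow_add hd0]
      congr 1
      push_cast
      ring
    calc l / 2 * Real.exp l
        ≤ (64 * C + 1) * (d : ℝ) ^ (δ / 2) * (Real.exp (128 * C) * (d : ℝ) ^ (δ / 2)) := by
          rw [e1]; gcongr
      _ = κ * ((d : ℝ) ^ (δ / 2) * (d : ℝ) ^ (δ / 2)) := by rw [hκ]; ring
      _ = κ * d ^ 2 * lam := by rw [e3]; ring
  obtain ⟨S, hSU, hS, hcard⟩ := exists_independent_of_sparse (R := Conflict G) (lam := lam)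
    (K := κ * d ^ 2) (D := 4 * d ^ 2) (T := 64 * (d ^ 2 * Q)) (l := l)
    (by positivity) (fun a b h => h.symm) (by positivity) hT hKl hl0 (darts G)
    (fun a ha => conflict_self (by simpa [darts] using ha))
    (fun a _ => by
      have := card_conflict_le hG a
      rw [sq]
      exact_mod_cast this)
    (fun a _ => card_conflict_pairs_le hG hQ a)
  obtain ⟨M, hM, hMS⟩ := exists_isInducedMatching_of_pairwise S
    (fun a ha => by simpa [darts] using hSU ha) hS
  refine ⟨M, hM, le_trans ?_ (Nat.cast_le.2 hMS)⟩
  rw [card_darts hG] at hcard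
  push_cast at hcard
  set n : ℝ := (Fintype.card V : ℝ) with hn
  have hn0 : 0 ≤ n := by positivity
  have h1 : δ / 4 * Real.log d * (n * d) ≤ (κ + 4) * d ^ 2 * #S := by
    calc δ / 4 * Real.log d * (n * d) ≤ l / 2 * (n * d) := by
          gcongr
          linarith
      _ ≤ (κ * d ^ 2 + 4 * d ^ 2) * #S := hcard
      _ = _ := by ring
  calc δ / (4 * (κ + 4)) * (n / d * Real.log d)
      = (δ / 4 * Real.log d * (n * d)) / ((κ + 4) * d ^ 2) := by field_simp
    _ ≤ #S := by
      rw [div_le_iff₀ (by positivity)]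
      linarith

end InducedMatching

theorem mainTheorem1 (B : ℕ) (hB : 2 < B) :
    ∃ c : ℝ, 0 < c ∧
      ∀ (W : Type*) [Fintype W] (H : SimpleGraph W), Fintype.card W = B → H.IsBipartite →
      ∀ (V : Type*) [Fintype V] (G : SimpleGraph V) [DecidableRel G.Adj] (d : ℕ),
        1 ≤ d → G.IsRegularOfDegree d → H.Free G →
        ∃ M : G.Subgraph, M.IsInducedMatching ∧
          c * (((Fintype.card V : ℝ) / (d : ℝ)) * Real.log (d : ℝ)) ≤ (M.edgeSet.ncard : ℝ) := by
  obtain ⟨c, hc, h⟩ := InducedMatching.exists_isInducedMatching_of_regular (t := B) (by omega)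
  refine ⟨c, hc, ?_⟩
  rintro W _ H rfl hH V _ G _ d hd hG hfree
  exact h V G d hd hG (InducedMatching.exists_not_adj_of_free hH hfree)
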